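/- An \emph{$\omega$-Stone space} is a totally disconnected, locally compact, Hausdorff, second countable topological space (equivalently, the Stone space of a countable Boolean ring, with or without a $1$). For a Boolean space $X$, let $\mathrm{Co}(X)$ be the Boolean ring of compact open subsets of $X$. Let $R$ be a Boolean ring. For $A\in R$ write $(A)=\{C\in R\mid C\subseteq A\}$. An element $A\in R$ is \emph{pseudo-indecomposable (PI)} if for all $B\in R$ with $B\subseteq A$, either $(B)\cong(A)$ or $(A-B)\cong(A)$. The ring $R$ is \emph{primitive} if every element of $R$ is the disjoint union of finitely many PI elements, and a Boolean space $W$ is \emph{primitive} if $\mathrm{Co}(W)$ is primitive. Let $\mathscr{W}=\omega_1\cup\{o\}$ be the set of countable ordinals together with a new least element $o$, regarded as a commutative monoid with operation $a+b=\max\{a,b\}$ and zero element $o$. A \emph{$\mathscr{W}$-measure} on $R$ is a map $\sigma\colon R\to\mathscr{W}$ such that $\sigma(A\cup B)=\sigma(A)+\sigma(B)$ for disjoint $A,B\in R$, and $\sigma(A)=o$ iff $A=0$. For such a $\sigma$, write $A\cong_\sigma B$ if there is a ring isomorphism $\alpha\colon(A)\to(B)$ with $\sigma(\alpha(C))=\sigma(C)$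 for all $C\in(A)$. An element $A$ is \emph{$\sigma$-PI} if for all $B\in R$ with $B\subseteq A$, either $B\cong_\sigma A$ or $A-B\cong_\sigma A$; and $R$ is \emph{$\sigma$-primitive} if every element of $R$ is the disjoint union of finitely many $\sigma$-PI elements of $R$. Let $W$ be an $\omega$-Stone space with Cantor--Bendixson sequence $W^{(0)}=W$, $W^{(\xi+1)}=$ the set of limit points of $W^{(\xi)}$, and $W^{(\eta)}=\bigcap_{\xi<\eta}W^{(\xi)}$ for limit $\eta$. Let $K(W)$ be its perfect kernel, i.e. the eventual constant value of this sequence. Its \emph{rank function} is $r\colon K(W)\to\omega_1$, $r(x)=\min\{\xi\in\omega_1\mid x\notin\overline{W^{(\xi)}-K(W)}\}$, and the associated $\mathscr{W}$-measure $\sigma_r$ on $\mathrm{Co}(K(W))$ is given by $\sigma_r(\emptyset)=o$ and $\sigma_r(A)=\sup\{r(x)\mid x\in A\}$ for $A\neq\emptyset$. \textbf{Theorem.} Let $W$ be an $\omega$-Stone space. Then $W$ is primitive if and only if $\mathrm{Co}(K(W))$ is $\sigma_r$-primitive. -/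

import Mathlib

open Set TopologicalSpace
open scoped Ordinal symmDiff

universe u v

/-! ### Boolean rings

A Boolean ring, with or without a `1`, is a `GeneralizedBooleanAlgebra`: the product is `C ⊓ D`,
the sum is the symmetric difference `C ∆ D`, and `A \ B` is the relative complement. -/

section BooleanRing

variable {R : Type u} [GeneralizedBooleanAlgebra R]

theorem symmDiff_mem_Iic {A : R} (C D : Set.Iic A) : (C : R) ∆ (D : R) ∈ Set.Iic A :=
  symmDiff_le_sup.trans (sup_le C.2 D.2)

theorem inf_mem_Iic {A : R} (C D : Set.Iic A) : (C : R) ⊓ (D : R) ∈ Set.Iic A :=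
  inf_le_left.trans C.2

/-- A ring isomorphism `(A) → (B)` between the principal ideals `(A) = {C ∈ R | C ≤ A}` and
`(B) = {D ∈ R | D ≤ B}` of a Boolean ring `R`. -/
structure IdealIso (A B : R) extends Set.Iic A ≃ Set.Iic B where
  map_add' : ∀ C D : Set.Iic A,
    (toFun ⟨(C : R) ∆ (D : R), symmDiff_mem_Iic C D⟩ : R) = (toFun C : R) ∆ (toFun D : R)
  map_mul' : ∀ C D : Set.Iic A,
    (toFun ⟨(C : R) ⊓ (D : R), inf_mem_Iic C D⟩ : R) = (toFun C : R) ⊓ (toFun D : R)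

/-- `A` is pseudo-indecomposable (PI): for every `B ≤ A`, `(B) ≅ (A)` or `(A - B) ≅ (A)`. -/
def IsPI (A : R) : Prop :=
  ∀ B : R, B ≤ A → Nonempty (IdealIso B A) ∨ Nonempty (IdealIso (A \ B) A)

/-- `A` is the disjoint union of finitely many elements satisfying `p`. -/
def IsFiniteDisjointUnionOf (p : R → Prop) (A : R) : Prop :=
  ∃ (n : ℕ) (F : Fin n → R), Pairwise (fun i j => Disjoint (F i) (F j)) ∧ (∀ i, p (F i)) ∧
    Finset.univ.sup F = A

/-- A Boolean ring is primitive if every element is a finite disjoint union of PI elements. -/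
def IsPrimitiveRing (R : Type u) [GeneralizedBooleanAlgebra R] : Prop :=
  ∀ A : R, IsFiniteDisjointUnionOf (IsPI (R := R)) A

/-- An `M`-measure on a Boolean ring `R`, where `M` is an m-monoid, i.e. a commutative monoid
whose zero element is its only unit. -/
structure MMeasure (R : Type u) [GeneralizedBooleanAlgebra R]
    (M : Type v) [AddCommMonoid M] [Subsingleton (AddUnits M)] where
  toFun : R → M
  map_disjoint_sup : ∀ A B : R, Disjoint A B → toFun (A ⊔ B) = toFun A + toFun B
  map_eq_zero_iff : ∀ A : R, toFun A = 0 ↔ A = ⊥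

variable {M : Type v} [AddCommMonoid M] [Subsingleton (AddUnits M)]

/-- `A ≅_σ B`: there is an isomorphism `(A) → (B)` that preserves `σ`. -/
def SigmaIso (σ : MMeasure R M) (A B : R) : Prop :=
  ∃ α : IdealIso A B, ∀ C : Set.Iic A, σ.toFun (α.toFun C : R) = σ.toFun (C : R)

/-- `A` is `σ`-pseudo-indecomposable. -/
def IsSigmaPI (σ : MMeasure R M) (A : R) : Prop :=
  ∀ B : R, B ≤ A → SigmaIso σ B A ∨ SigmaIso σ (A \ B) A

/-- `R` is `σ`-primitive: every element is a finite disjoint union of `σ`-PI elements. -/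
def IsSigmaPrimitive (σ : MMeasure R M) : Prop :=
  ∀ A : R, IsFiniteDisjointUnionOf (IsSigmaPI σ) A

end BooleanRing

/-! ### The m-monoid `𝒲` -/

/-- `𝒲`: the countable ordinals together with a new least element `o = ⊥`. -/
def ScriptW : Type (u + 1) := WithBot (Set.Iio (ω₁ : Ordinal.{u}))

namespace ScriptW

noncomputable instance : LinearOrder ScriptW.{u} :=
  inferInstanceAs (LinearOrder (WithBot (Set.Iio (ω₁ : Ordinal.{u}))))

instance : OrderBot ScriptW.{u} :=
  inferInstanceAs (OrderBot (WithBot (Set.Iio (ω₁ : Ordinal.{u}))))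

/-- A countable ordinal as an element of `𝒲`. -/
def ofOrdinal (ξ : Set.Iio (ω₁ : Ordinal.{u})) : ScriptW.{u} :=
  WithBot.some ξ

theorem ofOrdinal_le_ofOrdinal {ξ η : Set.Iio (ω₁ : Ordinal.{u})} :
    ofOrdinal ξ ≤ ofOrdinal η ↔ ξ ≤ η :=
  WithBot.coe_le_coe

theorem ofOrdinal_ne_bot (ξ : Set.Iio (ω₁ : Ordinal.{u})) : ofOrdinal ξ ≠ ⊥ :=
  WithBot.coe_ne_bot

theorem eq_bot_or_ofOrdinal (w : ScriptW.{u}) : w = ⊥ ∨ ∃ ξ, w = ofOrdinal ξ := by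
  cases w using WithBot.recBotCoe with
  | bot => exact Or.inl rfl
  | coe ξ => exact Or.inr ⟨ξ, rfl⟩

/-- The operation of `𝒲` is `a + b = max a b`; its zero element is `o`. -/
noncomputable instance : Add ScriptW.{u} := ⟨fun a b => max a b⟩

instance : Zero ScriptW.{u} := ⟨⊥⟩

noncomputable instance : AddCommMonoid ScriptW.{u} where
  add_assoc := max_assoc
  zero_add := max_bot_left
  add_zero := max_bot_right
  add_comm := max_comm
  nsmul := nsmulRec

theorem add_def (a b : ScriptW.{u}) : a + b = max a b := rfl

theorem zero_def : (0 : ScriptW.{u}) = ⊥ := rfl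

instance : Subsingleton (AddUnits ScriptW.{u}) where
  allEq a b := by
    have h : ∀ c : AddUnits ScriptW.{u}, (c : ScriptW.{u}) = ⊥ := fun c => by
      have hc : max (c : ScriptW.{u}) ((-c : AddUnits ScriptW.{u}) : ScriptW.{u}) = ⊥ :=
        AddUnits.add_neg c
      exact le_bot_iff.1 (hc ▸ le_max_left _ _)
    exact AddUnits.ext ((h a).trans (h b).symm)

end ScriptW

/-! ### `ω`-Stone spaces and their invariants -/

/-- An `ω`-Stone space: a Boolean space (totally disconnected, locally compact, Hausdorff) that is
second countable, i.e. the Stone space of a countable Boolean ring. -/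
class OmegaStoneSpace (W : Type u) [TopologicalSpace W] : Prop extends
  T2Space W, LocallyCompactSpace W, TotallyDisconnectedSpace W, SecondCountableTopology W

/-- A Boolean space is primitive if its Boolean ring of compact open subsets is primitive. -/
def IsPrimitiveSpace (W : Type u) [TopologicalSpace W] [T2Space W] : Prop :=
  IsPrimitiveRing (CompactOpens W)

section Rank

theorem exists_mem_of_ne_bot {X : Type u} [TopologicalSpace X] {A : CompactOpens X} (h : A ≠ ⊥) : ∃ x, x ∈ A := by
  by_contra hA
  push Not at hA
  exact h (SetLike.ext fun x => ⟨fun hx => absurd hx (hA x), fun hx => absurd hx (by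
    simp [← SetLike.mem_coe])⟩)

variable (W : Type u) [TopologicalSpace W]

/-- `W^(ξ)`, the `ξ`-th term of the Cantor-Bendixson sequence of `W`. -/
noncomputable def cbSeq (ξ : Ordinal.{u}) : Set W :=
  CantorBendixson.iteratedDerivedSet (Set.univ : Set W) ξ

/-- `K(W)`, the perfect kernel of `W`: the eventual value of the sequence `W^(ξ)`. -/
def kernel : Set W :=
  CantorBendixson.perfectKernel (Set.univ : Set W)

variable [OmegaStoneSpace W]

/-- The Cantor-Bendixson sequence of an `ω`-Stone space reaches `K(W)` at a countable ordinal. -/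
theorem exists_cbSeq_eq_kernel : ∃ ξ : Ordinal.{u}, ξ < ω₁ ∧ cbSeq W ξ = kernel W := by
  have hcl : ∀ ξ, IsClosed (cbSeq W ξ) :=
    CantorBendixson.isClosed_iteratedDerivedSet isClosed_univ
  have hanti : Antitone (cbSeq W) := CantorBendixson.iteratedDerivedSet_antitone _
  by_contra hne
  push Not at hne
  have hex : ∀ ξ : Set.Iio (ω₁ : Ordinal.{u}), ∃ x, x ∈ cbSeq W ξ ∧ x ∉ cbSeq W (ξ + 1) := by
    intro ξ
    by_contra h
    push Not at h
    refine hne ξ ξ.2 (CantorBendixson.perfectKernel_eq_iteratedDerivedSet_of_mem_fixedPoints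
      (CantorBendixson.mem_fixedPoints_of_iteratedDerivedSet_succ_eq
        (subset_antisymm (hanti (le_add_of_nonneg_right zero_le_one)) h))).symm
  choose x hx hx' using hex
  have hB : ∀ ξ : Set.Iio (ω₁ : Ordinal.{u}), ∃ U ∈ countableBasis W,
      x ξ ∈ U ∧ U ⊆ (cbSeq W (ξ + 1))ᶜ := fun ξ =>
    (isBasis_countableBasis W).exists_subset_of_mem_open (hx' ξ) (hcl _).isOpen_compl
  choose U hU hxU hUs using hB
  have hlt : ∀ ξ η, ξ < η → U ξ ≠ U η := by
    intro ξ η hlt h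
    have h1 : x η ∈ U ξ := h ▸ hxU η
    exact hUs ξ h1 (hanti (Order.add_one_le_of_lt hlt) (hx η))
  have hinj : Function.Injective
      (fun ξ : Set.Iio (ω₁ : Ordinal.{u}) => (⟨U ξ, hU ξ⟩ : countableBasis W)) := by
    intro ξ η h
    have h' : U ξ = U η := congrArg Subtype.val h
    rcases lt_trichotomy ξ η with hl | hl | hl
    · exact absurd h' (hlt _ _ hl)
    · exact hl
    · exact absurd h'.symm (hlt _ _ hl)
  have : Countable (countableBasis W) := (countable_countableBasis W).to_subtype
  have hc : Countable (Set.Iio (ω₁ : Ordinal.{u})) := hinj.countable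
  have h2 := Cardinal.mk_le_aleph0_iff.2 hc
  rw [Cardinal.mk_Iio_ordinal, Cardinal.lift_le_aleph0, Ordinal.card_omega] at h2
  exact absurd h2 (not_le.2 Cardinal.aleph0_lt_aleph_one)

theorem exists_notMem_closure : ∃ ξ : Ordinal.{u}, ξ < ω₁ ∧
    ∀ x : W, x ∉ closure (cbSeq W ξ \ kernel W) := by
  obtain ⟨ξ, hξ, h⟩ := exists_cbSeq_eq_kernel W
  exact ⟨ξ, hξ, fun x => by simp [h]⟩

variable {W}

theorem rankSet_nonempty (x : kernel W) :
    {ξ : Ordinal.{u} | ξ < ω₁ ∧ (x : W) ∉ closure (cbSeq W ξ \ kernel W)}.Nonempty := by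
  obtain ⟨ξ, hξ, h⟩ := exists_notMem_closure W
  exact ⟨ξ, hξ, h x⟩

/-- The rank function `r_W : K(W) → ω₁`,
`r_W(x) = min {ξ ∈ ω₁ | x ∉ closure (W^(ξ) - K(W))}`. -/
noncomputable def rankFn (x : kernel W) : Set.Iio (ω₁ : Ordinal.{u}) :=
  ⟨sInf {ξ : Ordinal.{u} | ξ < ω₁ ∧ (x : W) ∉ closure (cbSeq W ξ \ kernel W)},
    (csInf_mem (rankSet_nonempty x)).1⟩

variable (W) in
theorem exists_rankFn_le : ∃ θ : Set.Iio (ω₁ : Ordinal.{u}), ∀ x : kernel W, rankFn x ≤ θ := by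
  obtain ⟨ξ, hξ, h⟩ := exists_notMem_closure W
  exact ⟨⟨ξ, hξ⟩, fun x => Subtype.coe_le_coe.1 (csInf_le' (show ξ ∈ {ξ : Ordinal.{u} | ξ < ω₁ ∧
    (x : W) ∉ closure (cbSeq W ξ \ kernel W)} from ⟨hξ, h x⟩))⟩

theorem bddAbove_rankFn (A : CompactOpens (kernel W)) :
    BddAbove (Set.range fun x : A => (rankFn (x : kernel W) : Ordinal.{u})) := by
  obtain ⟨θ, h⟩ := exists_rankFn_le W
  exact ⟨θ, by rintro _ ⟨x, rfl⟩; exact h x⟩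

theorem iSup_rankFn_lt (A : CompactOpens (kernel W)) :
    ⨆ x : A, (rankFn (x : kernel W) : Ordinal.{u}) < ω₁ := by
  obtain ⟨θ, h⟩ := exists_rankFn_le W
  exact lt_of_le_of_lt (ciSup_le' (f := fun x : A => (rankFn (x : kernel W) : Ordinal.{u}))
    (a := (θ : Ordinal.{u})) fun x => h x) θ.2

open Classical in
/-- `σ_r(∅) = o`, and `σ_r(A) = sup {r_W(x) | x ∈ A}` for nonempty compact open `A ⊆ K(W)`. -/
noncomputable def sigmaFun (A : CompactOpens (kernel W)) : ScriptW.{u} :=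
  if A = ⊥ then ⊥
  else ScriptW.ofOrdinal ⟨⨆ x : A, (rankFn (x : kernel W) : Ordinal.{u}), iSup_rankFn_lt A⟩

theorem sigmaFun_le_iff (A : CompactOpens (kernel W)) (w : ScriptW.{u}) :
    sigmaFun A ≤ w ↔ ∀ x ∈ A, ScriptW.ofOrdinal (rankFn x) ≤ w := by
  unfold sigmaFun
  split_ifs with h
  · subst h
    simp [← SetLike.mem_coe]
  · obtain ⟨y, hy⟩ := exists_mem_of_ne_bot h
    rcases ScriptW.eq_bot_or_ofOrdinal w with rfl | ⟨ξ, rfl⟩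
    · simp only [le_bot_iff, ScriptW.ofOrdinal_ne_bot, false_iff]
      exact fun H => H y hy
    · simp only [ScriptW.ofOrdinal_le_ofOrdinal]
      constructor
      · intro H x hx
        exact (le_ciSup (bddAbove_rankFn A) ⟨x, hx⟩).trans H
      · intro H
        exact ciSup_le' (f := fun x : A => (rankFn (x : kernel W) : Ordinal.{u}))
          (a := (ξ : Ordinal.{u})) fun x => H x x.2

variable (W) in
/-- The `𝒲`-measure `σ_r` on the ring of compact open subsets of `K(W)` that is associated with
the rank function `r = r_W`. -/
noncomputable def sigmaMeasure : MMeasure (CompactOpens (kernel W)) ScriptW.{u} where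
  toFun := sigmaFun
  map_disjoint_sup A B _ := by
    rw [ScriptW.add_def]
    refine eq_of_forall_ge_iff fun w => ?_
    simp only [max_le_iff, sigmaFun_le_iff, ← SetLike.mem_coe, CompactOpens.coe_sup,
      Set.mem_union, or_imp, forall_and]
  map_eq_zero_iff A := by
    rw [ScriptW.zero_def]
    unfold sigmaFun
    split_ifs with h
    · simp [h]
    · simp [h, ScriptW.ofOrdinal_ne_bot]

end Rank

/-! ### Ring isomorphisms of principal ideals as order isomorphisms -/

section IdealIso

variable {R : Type u} [GeneralizedBooleanAlgebra R] {A B : R}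

/-! A compact open `A ⊆ W` carries two invariants: its trace on the perfect kernel, with the rank
measure, and the number of its non-kernel points at each Cantor-Bendixson stage, all infinite counts
being identified (`SameInvariants`). These determine the ideal `(A)` up to isomorphism. By Vaught's
criterion it suffices that equality of invariants lifts disjoint splittings
(`SameInvariants.exists_split`). That holds because, for a given trace measure, all counts are fixed
by the count at the first stage where it is finite, and compact open sets with a given trace and a
given such count can be built by hand. Conversely, an isomorphism of ideals induces a homeomorphism
of the underlying sets, so it preserves derivatives, kernel and rank
(`IdealIso.sigmaIso_kernelPart`).

Hence traces of PI sets are `σ_r`-PI, and a decomposition in `W` restricts to one in the kernel. In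
the other direction, a `σ_r`-PI set `G` lifts to a compact open `C` whose scattered points are as
few as the ranks on `G` permit. The counts of `C` are then forced by the measure, so `C` inherits
indecomposability from `G`. Removing such lifts leaves a compact open set that misses the kernel,
and it splits into PI pieces by induction on Cantor-Bendixson stage. -/

theorem IdealIso.le_iff (e : IdealIso A B) (C D : Set.Iic A) :
    (e.toFun C : R) ≤ e.toFun D ↔ (C : R) ≤ D := by
  rw [← inf_eq_left, ← e.map_mul', ← inf_eq_left (a := (C : R)), Subtype.coe_inj]
  exact (e.toEquiv.injective.eq_iff).trans Subtype.ext_iff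

/-- The order isomorphism underlying a ring isomorphism of principal ideals. -/
def IdealIso.toOrderIso (e : IdealIso A B) : Set.Iic A ≃o Set.Iic B where
  toEquiv := e.toEquiv
  map_rel_iff' {C D} := e.le_iff C D

theorem OrderIso.Iic_coe_sup (f : Set.Iic A ≃o Set.Iic B) (C D : Set.Iic A) :
    (f (C ⊔ D) : R) = (f C : R) ⊔ f D := by
  rw [map_sup]; rfl

theorem OrderIso.Iic_coe_inf (f : Set.Iic A ≃o Set.Iic B) (C D : Set.Iic A) :
    (f (C ⊓ D) : R) = (f C : R) ⊓ f D := by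
  rw [map_inf]; rfl

theorem OrderIso.Iic_coe_bot (f : Set.Iic A ≃o Set.Iic B) : (f ⊥ : R) = ⊥ := by
  rw [map_bot]; rfl

theorem OrderIso.Iic_disjoint_iff (f : Set.Iic A ≃o Set.Iic B) (C D : Set.Iic A) :
    Disjoint (f C : R) (f D) ↔ Disjoint (C : R) D := by
  rw [disjoint_iff, ← f.Iic_coe_inf, ← f.Iic_coe_bot, Subtype.coe_inj, f.injective.eq_iff,
    Subtype.ext_iff, disjoint_iff]
  rfl

theorem OrderIso.Iic_coe_sdiff (f : Set.Iic A ≃o Set.Iic B) (C D : Set.Iic A) :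
    (f ⟨(C : R) \ D, sdiff_le.trans C.2⟩ : R) = (f C : R) \ f D := by
  apply le_antisymm
  · rw [le_sdiff]
    exact ⟨f.monotone (show _ ≤ C from sdiff_le),
      (f.Iic_disjoint_iff _ _).2 disjoint_sdiff_self_left⟩
  · rw [sdiff_le_iff, ← f.Iic_coe_sup]
    exact f.monotone (show (C : R) ≤ (D : R) ⊔ (C : R) \ D by simp)

/-- An order isomorphism of principal ideals is a ring isomorphism. -/
def IdealIso.ofOrderIso (f : Set.Iic A ≃o Set.Iic B) : IdealIso A B where
  toEquiv := f.toEquiv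
  map_add' C D := by
    change (f (⟨(C : R) \ D, sdiff_le.trans C.2⟩ ⊔ ⟨(D : R) \ C, sdiff_le.trans D.2⟩) : R) = _
    rw [f.Iic_coe_sup, f.Iic_coe_sdiff, f.Iic_coe_sdiff]
    rfl
  map_mul' C D := f.Iic_coe_inf C D

theorem IdealIso.toFun_ofOrderIso (f : Set.Iic A ≃o Set.Iic B) (C : Set.Iic A) :
    (IdealIso.ofOrderIso f).toFun C = f C := rfl

theorem IdealIso.toOrderIso_apply (e : IdealIso A B) (C : Set.Iic A) :
    e.toOrderIso C = e.toFun C := rfl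

/-- The restriction of an order isomorphism of principal ideals to a smaller principal ideal. -/
def OrderIso.restrictIic (f : Set.Iic A ≃o Set.Iic B) (C : Set.Iic A) :
    Set.Iic (C : R) ≃o Set.Iic (f C : R) where
  toFun X := ⟨f ⟨X, X.2.trans C.2⟩, f.monotone (show _ ≤ C from X.2)⟩
  invFun Y := ⟨f.symm ⟨Y, Y.2.trans (f C).2⟩, by
    have : f.symm ⟨Y, Y.2.trans (f C).2⟩ ≤ f.symm (f C) := f.symm.monotone Y.2
    rwa [f.symm_apply_apply] at this⟩
  left_inv X := by
    have h := congrArg (Subtype.val : Set.Iic A → R)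
      (f.symm_apply_apply ⟨X, X.2.trans C.2⟩)
    exact Subtype.ext h
  right_inv Y := by
    have h := congrArg (Subtype.val : Set.Iic B → R)
      (f.apply_symm_apply ⟨Y, Y.2.trans (f C).2⟩)
    exact Subtype.ext h
  map_rel_iff' {X Y} := f.le_iff_le

variable {M : Type v} [AddCommMonoid M] [Subsingleton (AddUnits M)] {σ : MMeasure R M}

theorem SigmaIso.refl (σ : MMeasure R M) (A : R) : SigmaIso σ A A :=
  ⟨IdealIso.ofOrderIso (OrderIso.refl _), fun _ => rfl⟩

theorem SigmaIso.symm (h : SigmaIso σ A B) : SigmaIso σ B A := by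
  obtain ⟨e, he⟩ := h
  refine ⟨IdealIso.ofOrderIso e.toOrderIso.symm, fun C => ?_⟩
  rw [IdealIso.toFun_ofOrderIso, ← he, ← IdealIso.toOrderIso_apply, OrderIso.apply_symm_apply]

theorem SigmaIso.measure_eq (h : SigmaIso σ A B) : σ.toFun A = σ.toFun B := by
  obtain ⟨e, he⟩ := h
  have h1 := he ⊤
  rw [← IdealIso.toOrderIso_apply, map_top] at h1
  exact h1.symm

theorem SigmaIso.exists_split {A₁ A₂ : R} (hd : Disjoint A₁ A₂) (h : SigmaIso σ (A₁ ⊔ A₂) B) :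
    ∃ B₁ B₂, Disjoint B₁ B₂ ∧ B₁ ⊔ B₂ = B ∧ SigmaIso σ A₁ B₁ ∧ SigmaIso σ A₂ B₂ := by
  obtain ⟨e, he⟩ := h
  have key : ∀ C : Set.Iic (A₁ ⊔ A₂), SigmaIso σ (C : R) (e.toOrderIso C : R) := fun C =>
    ⟨IdealIso.ofOrderIso (e.toOrderIso.restrictIic C), fun X => he ⟨X, X.2.trans C.2⟩⟩
  refine ⟨_, _, ?_, ?_, key ⟨A₁, le_sup_left⟩, key ⟨A₂, le_sup_right⟩⟩
  · exact (e.toOrderIso.Iic_disjoint_iff _ _).2 hd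
  · rw [← OrderIso.Iic_coe_sup]
    have : (⟨A₁, le_sup_left⟩ ⊔ ⟨A₂, le_sup_right⟩ : Set.Iic (A₁ ⊔ A₂)) = ⊤ := rfl
    rw [this, map_top]
    rfl

end IdealIso

/-! ### Vaught's back-and-forth criterion -/

section BackAndForth

variable {R : Type u} [GeneralizedBooleanAlgebra R]

/-- Two matching binary trees of successive partitions of `C []` and `D []`, such that every element
of `R` is eventually decided by both trees. -/
structure MatchingRefinement (C D : List Bool → R) : Prop where
  sup_left : ∀ w, C (true :: w) ⊔ C (false :: w) = C w
  sup_right : ∀ w, D (true :: w) ⊔ D (false :: w) = D w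
  disjoint_left : ∀ w, Disjoint (C (true :: w)) (C (false :: w))
  disjoint_right : ∀ w, Disjoint (D (true :: w)) (D (false :: w))
  eq_bot_iff : ∀ w, C w = ⊥ ↔ D w = ⊥
  decides_left : ∀ a, ∃ n, ∀ w : List Bool, w.length = n → C w ≤ a ∨ Disjoint (C w) a
  decides_right : ∀ a, ∃ n, ∀ w : List Bool, w.length = n → D w ≤ a ∨ Disjoint (D w) a

namespace MatchingRefinement

variable {C D : List Bool → R}

theorem symm (h : MatchingRefinement C D) : MatchingRefinement D C :=
  ⟨h.sup_right, h.sup_left, h.disjoint_right, h.disjoint_left, fun w => (h.eq_bot_iff w).symm,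
    h.decides_right, h.decides_left⟩

/-- `a` and `b` contain corresponding nodes at level `n`, and are disjoint from all others. -/
def Corresp (C D : List Bool → R) (n : ℕ) (a b : R) : Prop :=
  ∀ w : List Bool, w.length = n → (C w ≤ a ∧ D w ≤ b) ∨ (Disjoint (C w) a ∧ Disjoint (D w) b)

theorem Corresp.symm {n : ℕ} {a b : R} (h : Corresp C D n a b) : Corresp D C n b a :=
  fun w hw => (h w hw).imp And.symm And.symm

theorem cons_le_left (h : MatchingRefinement C D) (b : Bool) (w : List Bool) : C (b :: w) ≤ C w := by
  rw [← h.sup_left w]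
  cases b
  · exact le_sup_right
  · exact le_sup_left

theorem Corresp.mono (h : MatchingRefinement C D) {n m : ℕ} (hnm : n ≤ m) {a b : R}
    (hc : Corresp C D n a b) : Corresp C D m a b := by
  induction m, hnm using Nat.le_induction with
  | base => exact hc
  | succ m _ ih =>
    rintro (_ | ⟨c, w⟩) hw
    · simp at hw
    · refine (ih w (by simpa using hw)).imp (fun H => ?_) (fun H => ?_)
      · exact ⟨(h.cons_le_left c w).trans H.1, (h.symm.cons_le_left c w).trans H.2⟩
      · exact ⟨H.1.mono_left (h.cons_le_left c w), H.2.mono_left (h.symm.cons_le_left c w)⟩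

/-- The nodes at level `n` join to `D []`, so an inequality below `D []` can be tested node by node.
-/
theorem inf_le_of_forall (h : MatchingRefinement C D) {x y : R} (n : ℕ)
    (hxy : ∀ w : List Bool, w.length = n → D w ⊓ x ≤ y) : D [] ⊓ x ≤ y := by
  induction n with
  | zero => exact hxy [] rfl
  | succ n ih =>
    refine ih fun w hw => ?_
    rw [← h.sup_right w, inf_sup_right]
    exact sup_le (hxy _ (by simp [hw])) (hxy _ (by simp [hw]))

/-- Prescribed pieces of the nodes at one level glue, since these nodes are disjoint; the induction
merges the pieces of two siblings into one piece of their parent. -/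
theorem exists_inf_eq (h : MatchingRefinement C D) (n : ℕ) (f : List Bool → R)
    (hf : ∀ w, f w ≤ D w) : ∃ d ≤ D [], ∀ w : List Bool, w.length = n → D w ⊓ d = f w := by
  induction n generalizing f with
  | zero =>
    refine ⟨f [], hf [], fun w hw => ?_⟩
    obtain rfl := List.length_eq_zero_iff.1 hw
    exact inf_eq_right.2 (hf [])
  | succ n ih =>
    obtain ⟨d, hd, hdf⟩ := ih (fun w => f (true :: w) ⊔ f (false :: w)) fun w => by
      rw [← h.sup_right w]
      exact sup_le_sup (hf _) (hf _)
    refine ⟨d, hd, ?_⟩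
    rintro (_ | ⟨c, w⟩) hw
    · simp at hw
    · rw [← inf_eq_left.2 (h.symm.cons_le_left c w), inf_assoc, hdf w (by simpa using hw),
        inf_sup_left]
      cases c
      · rw [((h.disjoint_right w).symm.mono_right (hf _)).eq_bot, bot_sup_eq,
          inf_eq_right.2 (hf _)]
      · rw [((h.disjoint_right w).mono_right (hf _)).eq_bot, sup_bot_eq,
          inf_eq_right.2 (hf _)]

theorem exists_corresp (h : MatchingRefinement C D) (a : R) :
    ∃ b ≤ D [], ∃ n, Corresp C D n a b := by
  classical
  obtain ⟨n, hn⟩ := h.decides_left a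
  obtain ⟨d, hd, hdf⟩ := h.exists_inf_eq n (fun w => if C w ≤ a then D w else ⊥) fun w => by
    split_ifs <;> simp
  refine ⟨d, hd, n, fun w hw => ?_⟩
  have h1 := hdf w hw
  by_cases hw' : C w ≤ a
  · rw [if_pos hw'] at h1
    exact Or.inl ⟨hw', inf_eq_left.1 h1⟩
  · rw [if_neg hw'] at h1
    exact Or.inr ⟨(hn w hw).resolve_left hw', disjoint_iff.2 h1⟩

/-- At a common level, a node inside `a` but disjoint from `a'` is empty on the left, hence empty on
the right. This one monotonicity gives well-definedness, both inverse laws and order preservation of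
the isomorphism. -/
theorem le_of_corresp (h : MatchingRefinement C D) {a b a' b' : R} {n n' : ℕ} (hb : b ≤ D [])
    (hc : Corresp C D n a b) (hc' : Corresp C D n' a' b') (haa : a ≤ a') : b ≤ b' := by
  have h1 := hc.mono h (le_max_left n n')
  have h2 := hc'.mono h (le_max_right n n')
  have := h.inf_le_of_forall (x := b) (y := b') (max n n') fun w hw => by
    rcases h1 w hw with h1 | h1
    · rcases h2 w hw with h2 | h2
      · exact inf_le_left.trans h2.2
      · have : C w = ⊥ := h2.1.eq_bot_of_le (h1.1.trans haa)
        rw [(h.eq_bot_iff w).1 this]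
        simp
    · rw [h1.2.eq_bot]
      exact bot_le
  rwa [inf_eq_right.2 hb] at this

theorem nonempty_idealIso (h : MatchingRefinement C D) : Nonempty (IdealIso (C []) (D [])) := by
  choose f hf n hn using h.exists_corresp
  choose g hg m hm using h.symm.exists_corresp
  refine ⟨IdealIso.ofOrderIso
    { toFun := fun a => ⟨f a, hf a⟩
      invFun := fun b => ⟨g b, hg b⟩
      left_inv := fun a => Subtype.ext (le_antisymm
        (h.symm.le_of_corresp (hg _) (hm (f a)) (hn a).symm le_rfl)
        (h.symm.le_of_corresp a.2 (hn a).symm (hm (f a)) le_rfl))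
      right_inv := fun b => Subtype.ext (le_antisymm
        (h.le_of_corresp (hf _) (hn (g b)) (hm b).symm le_rfl)
        (h.le_of_corresp b.2 (hm b).symm (hn (g b)) le_rfl))
      map_rel_iff' := fun {a b} => ⟨fun H => h.symm.le_of_corresp a.2 (hn a).symm (hn b).symm H,
        fun H => h.le_of_corresp (hf _) (hn a) (hn b) H⟩ }⟩

end MatchingRefinement

/-- Vaught's criterion: elements of a countable Boolean ring that are related by a symmetric
relation which lifts disjoint decompositions generate isomorphic ideals. -/
theorem nonempty_idealIso_of_backAndForth [Countable R] (rel : R → R → Prop)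
    (hsymm : ∀ C D, rel C D → rel D C) (hbot : ∀ D, rel ⊥ D → D = ⊥)
    (hsplit : ∀ C₁ C₂ D, Disjoint C₁ C₂ → rel (C₁ ⊔ C₂) D →
      ∃ D₁ D₂, Disjoint D₁ D₂ ∧ D₁ ⊔ D₂ = D ∧ rel C₁ D₁ ∧ rel C₂ D₂)
    {A B : R} (hAB : rel A B) : Nonempty (IdealIso A B) := by
  have hsplit' : ∀ C D a, rel C D → ∃ C₁ C₂ D₁ D₂, C₁ ≤ a ∧ Disjoint C₂ a ∧ C₁ ⊔ C₂ = C ∧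
      Disjoint C₁ C₂ ∧ Disjoint D₁ D₂ ∧ D₁ ⊔ D₂ = D ∧ rel C₁ D₁ ∧ rel C₂ D₂ := by
    intro C D a h
    have hs : C ⊓ a ⊔ C \ a = C := sup_inf_sdiff C a
    obtain ⟨D₁, D₂, h1, h2, h3, h4⟩ := hsplit (C ⊓ a) (C \ a) D
      (disjoint_iff.2 (inf_inf_sdiff C a)) (by rwa [hs])
    exact ⟨C ⊓ a, C \ a, D₁, D₂, inf_le_right, disjoint_sdiff_self_left, hs,
      disjoint_iff.2 (inf_inf_sdiff C a), h1, h2, h3, h4⟩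
  let P := {p : R × R // rel p.1 p.2}
  have step : ∀ (s : R ⊕ R) (p : P), ∃ q : Bool → P,
      (q true).1.1 ⊔ (q false).1.1 = p.1.1 ∧ (q true).1.2 ⊔ (q false).1.2 = p.1.2 ∧
      Disjoint (q true).1.1 (q false).1.1 ∧ Disjoint (q true).1.2 (q false).1.2 ∧
      (∀ a, s = Sum.inl a → (q true).1.1 ≤ a ∧ Disjoint (q false).1.1 a) ∧
      (∀ a, s = Sum.inr a → (q true).1.2 ≤ a ∧ Disjoint (q false).1.2 a) := by
    rintro (a | a) ⟨⟨C, D⟩, h⟩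
    · obtain ⟨C₁, C₂, D₁, D₂, h1, h2, h3, h4, h5, h6, h7, h8⟩ := hsplit' C D a h
      exact ⟨fun b => bif b then ⟨(C₁, D₁), h7⟩ else ⟨(C₂, D₂), h8⟩, h3, h6, h4, h5,
        fun b hb => by cases hb; exact ⟨h1, h2⟩, fun b hb => by cases hb⟩
    · obtain ⟨D₁, D₂, C₁, C₂, h1, h2, h3, h4, h5, h6, h7, h8⟩ := hsplit' D C a (hsymm _ _ h)
      exact ⟨fun b => bif b then ⟨(C₁, D₁), hsymm _ _ h7⟩ else ⟨(C₂, D₂), hsymm _ _ h8⟩,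
        h6, h3, h5, h4, fun b hb => (by cases hb),
        fun b hb => by cases hb; exact ⟨h1, h2⟩⟩
  choose q h1 h2 h3 h4 h5 h6 using step
  -- Depth `k` of the tree is split along `s k`, on the left or on the right, so the element `s n`
  -- is decided at depth `n + 1`. The newest branch is the head of the list.
  obtain ⟨s, hs⟩ := exists_surjective_nat (R ⊕ R)
  let T : List Bool → P := fun w =>
    List.rec (motive := fun _ => P) ⟨(A, B), hAB⟩ (fun b w p => q (s w.length) p b) w
  have hT : MatchingRefinement (fun w => (T w).1.1) (fun w => (T w).1.2) := by
    refine ⟨fun w => h1 _ _, fun w => h2 _ _, fun w => h3 _ _, fun w => h4 _ _, fun w => ?_,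
      fun a => ?_, fun a => ?_⟩
    · constructor
      · intro h
        exact hbot _ (h ▸ (T w).2)
      · intro h
        exact hbot _ (h ▸ hsymm _ _ (T w).2)
    · obtain ⟨n, hn⟩ := hs (Sum.inl a)
      refine ⟨n + 1, ?_⟩
      rintro (_ | ⟨b, w⟩) hw
      · simp at hw
      · have h := h5 (s w.length) (T w) a (by rw [← hn]; congr 1; simpa using hw)
        cases b
        · exact Or.inr h.2
        · exact Or.inl h.1
    · obtain ⟨n, hn⟩ := hs (Sum.inr a)
      refine ⟨n + 1, ?_⟩
      rintro (_ | ⟨b, w⟩) hw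
      · simp at hw
      · have h := h6 (s w.length) (T w) a (by rw [← hn]; congr 1; simpa using hw)
        cases b
        · exact Or.inr h.2
        · exact Or.inl h.1
  exact hT.nonempty_idealIso

end BackAndForth

/-! ### Derivatives and scattered parts -/

section CantorBendixsonSequence

open Filter Topology

variable {W : Type u} [TopologicalSpace W]

theorem isClosed_cbSeq (ξ : Ordinal.{u}) : IsClosed (cbSeq W ξ) :=
  CantorBendixson.isClosed_iteratedDerivedSet isClosed_univ ξ

theorem cbSeq_antitone : Antitone (cbSeq W) :=
  CantorBendixson.iteratedDerivedSet_antitone _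

theorem kernel_subset_cbSeq (ξ : Ordinal.{u}) : kernel W ⊆ cbSeq W ξ :=
  CantorBendixson.perfectKernel_subset_iteratedDerivedSet _ ξ

theorem isClosed_kernel : IsClosed (kernel W) :=
  CantorBendixson.isClosed_perfectKernel isClosed_univ

theorem cbSeq_zero : cbSeq W 0 = Set.univ :=
  CantorBendixson.iteratedDerivedSet_zero

theorem cbSeq_add_one (ξ : Ordinal.{u}) : cbSeq W (ξ + 1) = derivedSet (cbSeq W ξ) := by
  rw [← (isClosed_cbSeq ξ).relDerivedSet_eq]
  exact CantorBendixson.iteratedDerivedSet_succ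

theorem mem_cbSeq_limit {ξ : Ordinal.{u}} (hξ : Order.IsSuccLimit ξ) {x : W} :
    x ∈ cbSeq W ξ ↔ ∀ η < ξ, x ∈ cbSeq W η := by
  unfold cbSeq
  rw [CantorBendixson.iteratedDerivedSet_limit hξ]
  simp

theorem mem_cbSeq_add_one {ξ : Ordinal.{u}} {x : W} :
    x ∈ cbSeq W (ξ + 1) ↔ ∀ U : Set W, IsOpen U → x ∈ U → ∃ y ∈ U, y ∈ cbSeq W ξ ∧ y ≠ x := by
  rw [cbSeq_add_one, mem_derivedSet, accPt_iff_nhds]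
  constructor
  · intro h U hU hx
    obtain ⟨y, hy, hne⟩ := h U (hU.mem_nhds hx)
    exact ⟨y, hy.1, hy.2, hne⟩
  · intro h U hU
    obtain ⟨V, hVU, hV, hx⟩ := mem_nhds_iff.1 hU
    obtain ⟨y, hy, hy', hne⟩ := h V hV hx
    exact ⟨y, ⟨hVU hy, hy'⟩, hne⟩

theorem exists_cbRank {x : W} (hx : x ∉ kernel W) :
    ∃ α : Ordinal.{u}, x ∈ cbSeq W α ∧ x ∉ cbSeq W (α + 1) := by
  by_contra! h
  refine hx (Set.mem_iInter.2 fun ξ => ?_)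
  change x ∈ cbSeq W ξ
  induction ξ using Ordinal.limitRecOn with
  | zero => simp [cbSeq_zero]
  | add_one a ha => exact h a ha
  | limit a ha ih => exact (mem_cbSeq_limit ha).2 ih

/-- Limit points of the `α`-th derivative lie in the next one, which `T` avoids. So points of exact
rank `α` can be separated from the rest of that derivative. -/
theorem isClosed_cbSeq_diff {α : Ordinal.{u}} {T : Set W} (hT : Disjoint T (cbSeq W (α + 1))) :
    IsClosed (cbSeq W α \ T) := by
  rw [isClosed_iff_derivedSet_subset]
  intro x hx
  have h : x ∈ cbSeq W (α + 1) := by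
    rw [cbSeq_add_one]
    exact derivedSet_mono _ _ Set.sdiff_subset hx
  exact ⟨cbSeq_antitone (le_add_of_nonneg_right zero_le_one) h,
    fun hxT => Set.disjoint_left.1 hT hxT h⟩

theorem CompactOpens.mem_sup {X : Type u} [TopologicalSpace X] {A B : CompactOpens X} {x : X} :
    x ∈ A ⊔ B ↔ x ∈ A ∨ x ∈ B := Iff.rfl

theorem CompactOpens.notMem_bot {X : Type u} [TopologicalSpace X] {x : X} :
    x ∉ (⊥ : CompactOpens X) := id

theorem CompactOpens.mem_sdiff {X : Type u} [TopologicalSpace X] [T2Space X]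
    {A B : CompactOpens X} {x : X} : x ∈ A \ B ↔ x ∈ A ∧ x ∉ B := Iff.rfl

theorem CompactOpens.mem_inf {X : Type u} [TopologicalSpace X] [T2Space X]
    {A B : CompactOpens X} {x : X} : x ∈ A ⊓ B ↔ x ∈ A ∧ x ∈ B := Iff.rfl

theorem CompactOpens.disjoint_iff_forall {X : Type u} [TopologicalSpace X] [T2Space X]
    {A B : CompactOpens X} : Disjoint A B ↔ ∀ x ∈ A, x ∉ B := by
  rw [disjoint_iff]
  constructor
  · intro h x hA hB
    exact CompactOpens.notMem_bot (h ▸ CompactOpens.mem_inf.2 ⟨hA, hB⟩)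
  · intro h
    exact SetLike.ext fun x => ⟨fun (hx : x ∈ A ∧ x ∈ B) => (h x hx.1 hx.2).elim,
      fun hx => (CompactOpens.notMem_bot hx).elim⟩

/-- The trace of a compact open set on the perfect kernel. -/
def kernelPart (A : CompactOpens W) : CompactOpens (kernel W) where
  carrier := Subtype.val ⁻¹' (A : Set W)
  isCompact' := isClosed_kernel.isClosedEmbedding_subtypeVal.isCompact_preimage A.isCompact
  isOpen' := A.isOpen.preimage continuous_subtype_val

theorem kernelPart_mono {A B : CompactOpens W} (h : A ≤ B) : kernelPart A ≤ kernelPart B :=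
  fun _ hx => h hx

theorem kernelPart_sup (A B : CompactOpens W) :
    kernelPart (A ⊔ B) = kernelPart A ⊔ kernelPart B := rfl

theorem kernelPart_bot : kernelPart (⊥ : CompactOpens W) = ⊥ := rfl

/-- The points of `A` in the `ξ`-th derivative of `W` but outside the perfect kernel. -/
def scatteredPart (A : CompactOpens W) (ξ : Ordinal.{u}) : Set W :=
  (A ∩ cbSeq W ξ) \ kernel W

theorem mem_scatteredPart {A : CompactOpens W} {ξ : Ordinal.{u}} {x : W} :
    x ∈ scatteredPart A ξ ↔ (x ∈ A ∧ x ∈ cbSeq W ξ) ∧ x ∉ kernel W := Iff.rfl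

theorem scatteredPart_mono {A B : CompactOpens W} (h : A ≤ B) (ξ : Ordinal.{u}) :
    scatteredPart A ξ ⊆ scatteredPart B ξ :=
  fun _ hx => ⟨⟨h hx.1.1, hx.1.2⟩, hx.2⟩

theorem scatteredPart_antitone (A : CompactOpens W) : Antitone (scatteredPart A) :=
  fun _ _ h _ hx => ⟨⟨hx.1.1, cbSeq_antitone h hx.1.2⟩, hx.2⟩

theorem scatteredPart_sup (A B : CompactOpens W) (ξ : Ordinal.{u}) :
    scatteredPart (A ⊔ B) ξ = scatteredPart A ξ ∪ scatteredPart B ξ := by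
  ext x
  simp only [Set.mem_union, mem_scatteredPart, CompactOpens.mem_sup]
  tauto

end CantorBendixsonSequence

/-! ### Compact open sets with prescribed trace and count -/

section OmegaStone

open Filter Topology

variable {W : Type u} [TopologicalSpace W] [OmegaStoneSpace W]

instance : PrespectralSpace W where
  isTopologicalBasis := by
    refine isTopologicalBasis_of_isOpen_of_nhds (fun U hU => hU.1) fun x U hx hU => ?_
    obtain ⟨N, hN, hNU, hNc⟩ := local_compact_nhds (hU.mem_nhds hx)
    obtain ⟨V, hV, hxV, hVN⟩ :=
      (loc_compact_Haus_tot_disc_of_zero_dim (H := W)).mem_nhds_iff.1 hN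
    exact ⟨V, ⟨hV.2, hNc.of_isClosed_subset hV.1 hVN⟩, hxV, hVN.trans hNU⟩

theorem exists_compactOpens_between {S U : Set W} (hS : IsCompact S) (hU : IsOpen U) (h : S ⊆ U) :
    ∃ C : CompactOpens W, S ⊆ C ∧ (C : Set W) ⊆ U := by
  obtain ⟨C, h1, h2, h3, h4⟩ := PrespectralSpace.exists_isCompact_and_isOpen_between hS hU h
  exact ⟨⟨⟨C, h1⟩, h2⟩, h3, h4⟩

instance : Countable (CompactOpens W) := by
  have hb := isBasis_countableBasis W
  have hfin : ∀ A : CompactOpens W, ∃ F : Set (Set W), F.Finite ∧ F ⊆ countableBasis W ∧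
      ⋃₀ F = (A : Set W) := by
    intro A
    obtain ⟨F, hF, hFA⟩ := hb.open_eq_sUnion A.isOpen
    obtain ⟨G, hGF, hG, hAG⟩ := IsCompact.elim_finite_subcover_image (c := id)
      (CompactOpens.isCompact A) (fun s hs => hb.isOpen (hF hs))
      (hFA.trans Set.sUnion_eq_biUnion).subset
    replace hAG := hAG.trans (Set.sUnion_eq_biUnion (s := G)).superset
    exact ⟨G, hG, hGF.trans hF,
      Set.Subset.antisymm (hFA ▸ Set.sUnion_subset_sUnion hGF) hAG⟩
  choose F h1 h2 h3 using hfin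
  have hc := (Set.countable_ofPred_finite_subset (countable_countableBasis W)).to_subtype
  refine Function.Injective.countable
    (f := fun A => (⟨F A, h1 A, h2 A⟩ : {t : Set (Set W) | t.Finite ∧ t ⊆ countableBasis W}))
    fun A B h => CompactOpens.ext ?_
  rw [← h3 A, ← h3 B, show F A = F B from congrArg Subtype.val h]

theorem kernelPart_sdiff (A B : CompactOpens W) :
    kernelPart (A \ B) = kernelPart A \ kernelPart B := rfl

theorem disjoint_kernelPart {A B : CompactOpens W} (h : Disjoint A B) :
    Disjoint (kernelPart A) (kernelPart B) := by
  rw [CompactOpens.disjoint_iff_forall] at h ⊢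
  exact fun x hx => h x hx

theorem exists_kernelPart_eq {A : CompactOpens W} {G : CompactOpens (kernel W)}
    (h : G ≤ kernelPart A) : ∃ C ≤ A, kernelPart C = G := by
  obtain ⟨U, hU, hUG⟩ := isOpen_induced_iff.1 G.isOpen
  obtain ⟨C, h1, h2⟩ := exists_compactOpens_between (G.isCompact.image continuous_subtype_val)
    (hU.inter A.isOpen) (by
      rintro _ ⟨x, hx, rfl⟩
      exact ⟨by rwa [← hUG] at hx, h hx⟩)
  refine ⟨C, fun x hx => (h2 hx).2, SetLike.ext fun x => ⟨fun hx => ?_, fun hx => ?_⟩⟩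
  · change x ∈ (G : Set (kernel W))
    rw [← hUG]
    exact (h2 hx).1
  · exact h1 ⟨x, hx, rfl⟩

theorem lt_rankFn_iff {x : kernel W} {ξ : Ordinal.{u}} :
    ξ < (rankFn x : Ordinal.{u}) ↔ (x : W) ∈ closure (cbSeq W ξ \ kernel W) := by
  have hmem := csInf_mem (rankSet_nonempty x)
  constructor
  · intro h
    by_contra hx
    exact notMem_of_lt_csInf' h ⟨h.trans hmem.1, hx⟩
  · intro h
    by_contra! hx
    exact hmem.2 (closure_mono (Set.sdiff_subset_sdiff_left (cbSeq_antitone hx)) h)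

theorem encard_scatteredPart_sup {A B : CompactOpens W} (h : Disjoint A B) (ξ : Ordinal.{u}) :
    (scatteredPart (A ⊔ B) ξ).encard = (scatteredPart A ξ).encard + (scatteredPart B ξ).encard := by
  rw [scatteredPart_sup, Set.encard_union_eq]
  exact Set.disjoint_left.2 fun x hx hx' =>
    CompactOpens.disjoint_iff_forall.1 h x hx.1.1 hx'.1.1

theorem exists_scatteredPart_eq_empty (A : CompactOpens W) :
    ∃ ξ : Ordinal.{u}, scatteredPart A ξ = ∅ := by
  obtain ⟨ξ, -, h⟩ := exists_cbSeq_eq_kernel W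
  refine ⟨ξ, Set.eq_empty_of_forall_notMem fun x hx => hx.2 (h ▸ hx.1.2)⟩

/-- If the earlier stage were finite, deleting its other points and the kernel would leave a
neighbourhood isolating a point that survives to the next derivative. -/
theorem infinite_scatteredPart_of_lt {A : CompactOpens W} {ξ η : Ordinal.{u}} (h : ξ < η)
    (hne : (scatteredPart A η).Nonempty) : (scatteredPart A ξ).Infinite := by
  obtain ⟨y, ⟨hyA, hyη⟩, hyK⟩ := hne
  intro hfin
  obtain ⟨z, ⟨⟨hzA, hzK⟩, hz⟩, hzξ, hne⟩ := mem_cbSeq_add_one.1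
    (cbSeq_antitone (Order.add_one_le_of_lt h) hyη)
    (((A : Set W) ∩ (kernel W)ᶜ) ∩ (scatteredPart A ξ \ {y})ᶜ)
    ((A.isOpen.inter isClosed_kernel.isOpen_compl).inter
      (hfin.subset Set.sdiff_subset).isClosed.isOpen_compl)
    ⟨⟨hyA, hyK⟩, fun h => h.2 rfl⟩
  exact hz ⟨⟨⟨hzA, hzξ⟩, hzK⟩, hne⟩

theorem infinite_scatteredPart_of_lt_rankFn {A : CompactOpens W} {ξ : Ordinal.{u}} {x : kernel W}
    (hx : x ∈ kernelPart A) (h : ξ < (rankFn x : Ordinal.{u})) : (scatteredPart A ξ).Infinite := by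
  intro hfin
  obtain ⟨z, ⟨hzA, hz⟩, hz'⟩ := mem_closure_iff.1 (lt_rankFn_iff.1 h)
    ((A : Set W) ∩ (scatteredPart A ξ)ᶜ) (A.isOpen.inter hfin.isClosed.isOpen_compl)
    ⟨hx, fun h => h.2 x.2⟩
  exact hz ⟨⟨hzA, hz'.1⟩, hz'.2⟩

/-- The rank bound says that no kernel point of `A` is a limit of scattered points of stage `ξ`, so
the scattered part is already closed in `A`. -/
theorem isCompact_scatteredPart {A : CompactOpens W} {ξ : Ordinal.{u}}
    (h : ∀ x ∈ kernelPart A, (rankFn x : Ordinal.{u}) ≤ ξ) : IsCompact (scatteredPart A ξ) := by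
  have : scatteredPart A ξ = (A : Set W) ∩ closure (cbSeq W ξ \ kernel W) := by
    ext x
    constructor
    · intro hx
      exact ⟨hx.1.1, subset_closure ⟨hx.1.2, hx.2⟩⟩
    · rintro ⟨hxA, hx⟩
      refine ⟨⟨hxA, closure_minimal Set.sdiff_subset (isClosed_cbSeq ξ) hx⟩, fun hK => ?_⟩
      exact (h ⟨x, hK⟩ hxA).not_gt (lt_rankFn_iff.2 hx)
  rw [this]
  exact A.isCompact.inter_right isClosed_closure

/-- From stage `ξ` on the scattered parts are compact. If all were infinite before `α`, a point
would survive to `α`: an accumulation point at a successor, a point of a nested intersection at a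
limit. -/
theorem exists_finite_scatteredPart {A : CompactOpens W} {ξ α : Ordinal.{u}} (hξ : ξ < α)
    (h : ∀ x ∈ kernelPart A, (rankFn x : Ordinal.{u}) ≤ ξ) (hα : scatteredPart A α = ∅) :
    ∃ η < α, (scatteredPart A η).Finite := by
  by_contra! hinf
  have hc : ∀ η, ξ ≤ η → IsCompact (scatteredPart A η) := fun η hη =>
    isCompact_scatteredPart fun x hx => (h x hx).trans hη
  rcases Ordinal.zero_or_succ_or_isSuccLimit α with rfl | ⟨β, rfl⟩ | hlim
  · exact not_lt_bot hξ
  · have hβ : ξ ≤ β := Order.lt_succ_iff.1 hξ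
    obtain ⟨x, hx, hacc⟩ := (hinf β (Order.lt_succ β)).exists_accPt_of_subset_isCompact
      (hc β hβ) Set.Subset.rfl
    refine Set.notMem_empty x (hα ▸ ⟨⟨hx.1.1, ?_⟩, hx.2⟩)
    change x ∈ cbSeq W (β + 1)
    rw [cbSeq_add_one]
    exact hacc.mono (Filter.principal_mono.2 fun y hy => hy.1.2)
  · have : Nonempty (Set.Ico ξ α) := ⟨⟨ξ, le_rfl, hξ⟩⟩
    obtain ⟨x, hx⟩ := IsCompact.nonempty_iInter_of_directed_nonempty_isCompact_isClosed
      (fun η : Set.Ico ξ α => scatteredPart A η)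
      (fun a b => ⟨max a b,
        scatteredPart_antitone A (show (a : Ordinal) ≤ max a b from le_max_left a b),
        scatteredPart_antitone A (show (b : Ordinal) ≤ max a b from le_max_right a b)⟩)
      (fun η => (hinf η η.2.2).nonempty) (fun η => hc η η.2.1) (fun η => (hc η η.2.1).isClosed)
    rw [Set.mem_iInter] at hx
    have hxξ := hx ⟨ξ, le_rfl, hξ⟩
    refine Set.notMem_empty x (hα ▸ ⟨⟨hxξ.1.1, (mem_cbSeq_limit hlim).2 fun η hη => ?_⟩, hxξ.2⟩)
    rcases le_total ξ η with hle | hle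
    · exact (hx ⟨η, hle, hη⟩).1.2
    · exact cbSeq_antitone hle hxξ.1.2

/-- If only finitely many points have exact rank `α`, the later ones cannot accumulate by means of
them, so they accumulate on one another. They then form a preperfect set, which lies in the kernel
and is therefore empty. -/
theorem infinite_or_eq_scatteredPart_diff (A : CompactOpens W) (α : Ordinal.{u}) :
    (scatteredPart A α \ cbSeq W (α + 1)).Infinite ∨
      scatteredPart A α \ cbSeq W (α + 1) = scatteredPart A α := by
  by_contra! h
  obtain ⟨hfin, hne⟩ := h
  have hpre : Preperfect (scatteredPart A (α + 1)) := by
    intro y hy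
    rw [accPt_iff_nhds]
    intro U hU
    obtain ⟨V, hVU, hV, hyV⟩ := mem_nhds_iff.1 hU
    obtain ⟨z, ⟨⟨⟨hzV, hzA⟩, hzK⟩, hz⟩, hzα, hzy⟩ := mem_cbSeq_add_one.1 hy.1.2
      (((V ∩ A) ∩ (kernel W)ᶜ) ∩ (scatteredPart A α \ cbSeq W (α + 1))ᶜ)
      (((hV.inter A.isOpen).inter isClosed_kernel.isOpen_compl).inter hfin.isClosed.isOpen_compl)
      ⟨⟨⟨hyV, hy.1.1⟩, hy.2⟩, fun h => h.2 hy.1.2⟩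
    have hz1 : z ∈ cbSeq W (α + 1) := by
      by_contra hz'
      exact hz ⟨⟨⟨hzA, hzα⟩, hzK⟩, hz'⟩
    exact ⟨z, ⟨hVU hzV, ⟨hzA, hz1⟩, hzK⟩, hzy⟩
  have hK := hpre.perfect_closure.subset_perfectKernel (Set.subset_univ _)
  apply hne
  refine sdiff_eq_left.2 (Set.disjoint_left.2 fun x hx hx' => hx.2 (hK (subset_closure ?_)))
  exact ⟨⟨hx.1.1, hx'⟩, hx.2⟩

theorem exists_subset_scatteredPart_diff {A : CompactOpens W} {α : Ordinal.{u}} {n : ℕ}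
    (h : (n : ℕ∞) ≤ (scatteredPart A α).encard) :
    ∃ T ⊆ scatteredPart A α \ cbSeq W (α + 1), T.encard = n := by
  apply Set.exists_subset_encard_eq
  rcases infinite_or_eq_scatteredPart_diff A α with h1 | h1
  · rw [h1.encard_eq]
    exact le_top
  · rwa [h1]

/-- The unwanted scattered points form a compact set off the kernel, so a compact open set off the
kernel covers them and can be subtracted. -/
theorem exists_le_kernelPart_eq_disjoint {B : CompactOpens W} {G : CompactOpens (kernel W)}
    (hG : G ≤ kernelPart B) {α : Ordinal.{u}} (hr : ∀ x ∈ G, (rankFn x : Ordinal.{u}) ≤ α) :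
    ∃ C ≤ B, kernelPart C = G ∧ scatteredPart C α = ∅ := by
  obtain ⟨B₀, hB₀, rfl⟩ := exists_kernelPart_eq hG
  obtain ⟨C, hC, hCK⟩ := exists_compactOpens_between (isCompact_scatteredPart hr)
    isClosed_kernel.isOpen_compl fun x hx => hx.2
  refine ⟨B₀ \ C, sdiff_le.trans hB₀, ?_, ?_⟩
  · rw [kernelPart_sdiff, sdiff_eq_left, CompactOpens.disjoint_iff_forall]
    exact fun x _ h => hCK h x.2
  · refine Set.eq_empty_of_forall_notMem fun x hx => hx.1.1.2 (hC ?_)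
    exact ⟨⟨hx.1.1.1, hx.1.2⟩, hx.2⟩

theorem exists_le_kernelPart_eq_encard {B : CompactOpens W} {G : CompactOpens (kernel W)}
    (hG : G ≤ kernelPart B) {α : Ordinal.{u}} (hr : ∀ x ∈ G, (rankFn x : Ordinal.{u}) ≤ α)
    {n : ℕ} (hn : (n : ℕ∞) ≤ (scatteredPart B α).encard) :
    ∃ C ≤ B, kernelPart C = G ∧ (scatteredPart C α).encard = n := by
  obtain ⟨B₀, hB₀, hB₀G, hB₀α⟩ := exists_le_kernelPart_eq_disjoint hG hr
  obtain ⟨T, hT, hTn⟩ := exists_subset_scatteredPart_diff hn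
  have hTfin : T.Finite := Set.finite_of_encard_eq_coe hTn
  -- `E` avoids the kernel, and its only points at stage `α` are those of `T`; adding it keeps the
  -- trace and brings the count to `n`.
  obtain ⟨E, hTE, hE⟩ := exists_compactOpens_between hTfin.isCompact
    ((B.isOpen.inter isClosed_kernel.isOpen_compl).inter (isClosed_cbSeq_diff (T := T)
      (Set.disjoint_left.2 fun x hx => (hT hx).2)).isOpen_compl)
    fun x hx => ⟨⟨(hT hx).1.1.1, (hT hx).1.2⟩, fun h => h.2 hx⟩
  refine ⟨B₀ ⊔ E, sup_le hB₀ fun x hx => (hE hx).1.1, ?_, ?_⟩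
  · rw [kernelPart_sup, hB₀G, sup_eq_left]
    exact fun x hx => ((hE hx).1.2 x.2).elim
  · rw [scatteredPart_sup, hB₀α, Set.empty_union, ← hTn]
    congr 1
    ext x
    constructor
    · intro hx
      by_contra hxT
      exact (hE hx.1.1).2 ⟨hx.1.2, hxT⟩
    · intro hx
      exact ⟨⟨hTE hx, (hT hx).1.1.2⟩, (hT hx).1.2⟩

end OmegaStone

/-! ### The invariants determine the ideal -/

section Uniqueness

variable {W : Type u} [TopologicalSpace W] [OmegaStoneSpace W]

theorem rankFn_le_of_sigmaFun_eq {G H : CompactOpens (kernel W)} (h : sigmaFun G = sigmaFun H)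
    {ξ : Ordinal.{u}} (hG : ∀ x ∈ G, (rankFn x : Ordinal.{u}) ≤ ξ) :
    ∀ y ∈ H, (rankFn y : Ordinal.{u}) ≤ ξ := by
  intro y hy
  rcases lt_or_ge ξ ω₁ with hξ | hξ
  · have h1 : sigmaFun G ≤ ScriptW.ofOrdinal ⟨ξ, hξ⟩ :=
      (sigmaFun_le_iff G _).2 fun x hx => ScriptW.ofOrdinal_le_ofOrdinal.2 (hG x hx)
    rw [h, sigmaFun_le_iff] at h1
    exact ScriptW.ofOrdinal_le_ofOrdinal.1 (h1 y hy)
  · exact (rankFn y).2.le.trans hξ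

theorem exists_level (A : CompactOpens W) : ∃ α : Ordinal.{u}, (scatteredPart A α).Finite ∧
    ∀ ξ < α, (scatteredPart A ξ).Infinite := by
  obtain ⟨ξ, hξ⟩ := exists_scatteredPart_eq_empty A
  have hne : {ξ : Ordinal.{u} | (scatteredPart A ξ).Finite}.Nonempty := ⟨ξ, by
    rw [Set.mem_ofPred_eq, hξ]
    exact Set.finite_empty⟩
  exact ⟨_, csInf_mem hne, fun ξ hξ hf =>
    notMem_of_lt_csInf' (s := {ξ : Ordinal.{u} | (scatteredPart A ξ).Finite}) hξ hf⟩

/-- Above `α` both counts vanish. Below `α`, a finite count for `B` forces `B` to be empty at `α`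
and bounds its ranks; the bound passes to `A` through the measure, and compactness makes `A` finite
too early. -/
theorem encard_scatteredPart_eq_of_level {A B : CompactOpens W} {α : Ordinal.{u}}
    (hσ : sigmaFun (kernelPart A) = sigmaFun (kernelPart B)) (hfin : (scatteredPart A α).Finite)
    (hinf : ∀ ξ < α, (scatteredPart A ξ).Infinite)
    (he : (scatteredPart A α).encard = (scatteredPart B α).encard) (ξ : Ordinal.{u}) :
    (scatteredPart A ξ).encard = (scatteredPart B ξ).encard := by
  have hfinB : (scatteredPart B α).Finite := by
    rw [← Set.encard_lt_top_iff] at hfin ⊢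
    rwa [← he]
  rcases lt_trichotomy ξ α with hξ | rfl | hξ
  · rw [(hinf ξ hξ).encard_eq, eq_comm, Set.encard_eq_top_iff]
    rcases (scatteredPart B α).eq_empty_or_nonempty with hB | hB
    · by_contra hf
      have hr : ∀ x ∈ kernelPart B, (rankFn x : Ordinal.{u}) ≤ ξ := fun x hx => by
        by_contra! hlt
        exact hf (infinite_scatteredPart_of_lt_rankFn hx hlt)
      rw [hB, Set.encard_empty, Set.encard_eq_zero] at he
      obtain ⟨η, hη, hηf⟩ :=
        exists_finite_scatteredPart hξ (rankFn_le_of_sigmaFun_eq hσ.symm hr) he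
      exact hinf η hη hηf
    · exact infinite_scatteredPart_of_lt hξ hB
  · exact he
  · have key : ∀ C : CompactOpens W, (scatteredPart C α).Finite → scatteredPart C ξ = ∅ :=
      fun C hC => Set.not_nonempty_iff_eq_empty.1 fun hne =>
        infinite_scatteredPart_of_lt hξ hne hC
    rw [key A hfin, key B hfinB]

/-- Equivalence of the invariants of two compact open sets: their traces on the perfect kernel are
isomorphic with the rank measure, and their scattered parts have the same number of points at each
stage of the Cantor-Bendixson sequence. -/
def SameInvariants (A B : CompactOpens W) : Prop :=
  SigmaIso (sigmaMeasure W) (kernelPart A) (kernelPart B) ∧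
    ∀ ξ, (scatteredPart A ξ).encard = (scatteredPart B ξ).encard

theorem SameInvariants.symm {A B : CompactOpens W} (h : SameInvariants A B) :
    SameInvariants B A :=
  ⟨h.1.symm, fun ξ => (h.2 ξ).symm⟩

theorem SameInvariants.eq_bot {B : CompactOpens W} (h : SameInvariants ⊥ B) : B = ⊥ := by
  have hk : kernelPart B = ⊥ := by
    rw [← (sigmaMeasure W).map_eq_zero_iff, ← h.1.measure_eq, (sigmaMeasure W).map_eq_zero_iff]
    rfl
  have h0 : scatteredPart (⊥ : CompactOpens W) 0 = ∅ :=
    Set.eq_empty_of_forall_notMem fun x hx => CompactOpens.notMem_bot hx.1.1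
  have hB := h.2 0
  rw [h0, Set.encard_empty, eq_comm, Set.encard_eq_zero] at hB
  refine SetLike.ext fun x => ⟨fun hx => ?_, fun hx => (CompactOpens.notMem_bot hx).elim⟩
  by_cases hxK : x ∈ kernel W
  · have : (⟨x, hxK⟩ : kernel W) ∈ kernelPart B := hx
    rw [hk] at this
    exact (CompactOpens.notMem_bot this).elim
  · refine (Set.notMem_empty x (hB ▸ ⟨⟨hx, ?_⟩, hxK⟩)).elim
    rw [cbSeq_zero]
    trivial

/-- Only the part with the smaller level is built; the other is its complement. The order of the
levels makes the count of the built part finite at `α₂`, where it has to be cancelled. -/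
theorem SameInvariants.exists_split_of_level_le {A₁ A₂ B : CompactOpens W} (hd : Disjoint A₁ A₂)
    (h : SameInvariants (A₁ ⊔ A₂) B) {α₁ α₂ : Ordinal.{u}} (hα : α₁ ≤ α₂)
    (hfin₁ : (scatteredPart A₁ α₁).Finite) (hinf₁ : ∀ ξ < α₁, (scatteredPart A₁ ξ).Infinite)
    (hfin₂ : (scatteredPart A₂ α₂).Finite) (hinf₂ : ∀ ξ < α₂, (scatteredPart A₂ ξ).Infinite) :
    ∃ B₁ B₂, Disjoint B₁ B₂ ∧ B₁ ⊔ B₂ = B ∧ SameInvariants A₁ B₁ ∧ SameInvariants A₂ B₂ := by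
  obtain ⟨hσ, hcard⟩ := h
  obtain ⟨G₁, G₂, hGd, hG, hσ₁, hσ₂⟩ := SigmaIso.exists_split (disjoint_kernelPart hd) hσ
  obtain ⟨n, hn⟩ := hfin₁.exists_encard_eq_coe
  have hr : ∀ x ∈ kernelPart A₁, (rankFn x : Ordinal.{u}) ≤ α₁ := fun x hx => by
    by_contra! hlt
    exact infinite_scatteredPart_of_lt_rankFn hx hlt hfin₁
  obtain ⟨B₁, hB₁, rfl, hB₁n⟩ := exists_le_kernelPart_eq_encard (B := B) (G := G₁) (α := α₁)
    (n := n) (hG ▸ le_sup_left) (rankFn_le_of_sigmaFun_eq hσ₁.measure_eq hr) (by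
      rw [← hcard, encard_scatteredPart_sup hd, hn]
      exact le_self_add)
  have hcard₁ := encard_scatteredPart_eq_of_level hσ₁.measure_eq hfin₁ hinf₁ (hn.trans hB₁n.symm)
  have hBd : Disjoint B₁ (B \ B₁) := disjoint_sdiff_self_right
  have hBs : B₁ ⊔ B \ B₁ = B := sup_sdiff_cancel_right hB₁
  have hkB₂ : kernelPart (B \ B₁) = G₂ := by
    rw [kernelPart_sdiff, ← hG, sup_sdiff_left_self, sdiff_eq_left]
    exact hGd.symm
  rw [← hkB₂] at hσ₂
  refine ⟨B₁, B \ B₁, hBd, hBs, ⟨hσ₁, hcard₁⟩, hσ₂,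
    encard_scatteredPart_eq_of_level hσ₂.measure_eq hfin₂ hinf₂ ?_⟩
  have h2 := hcard α₂
  rw [← hBs, encard_scatteredPart_sup hd, encard_scatteredPart_sup hBd, hcard₁] at h2
  refine ENat.add_left_injective_of_ne_top ?_ ((add_comm _ _).trans (h2.trans (add_comm _ _)))
  rw [← hcard₁]
  exact Set.encard_ne_top_iff.2 (hfin₁.subset (scatteredPart_antitone A₁ hα))

theorem SameInvariants.exists_split {A₁ A₂ B : CompactOpens W} (hd : Disjoint A₁ A₂)
    (h : SameInvariants (A₁ ⊔ A₂) B) :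
    ∃ B₁ B₂, Disjoint B₁ B₂ ∧ B₁ ⊔ B₂ = B ∧ SameInvariants A₁ B₁ ∧ SameInvariants A₂ B₂ := by
  obtain ⟨α₁, hfin₁, hinf₁⟩ := exists_level A₁
  obtain ⟨α₂, hfin₂, hinf₂⟩ := exists_level A₂
  rcases le_total α₁ α₂ with hα | hα
  · exact h.exists_split_of_level_le hd hα hfin₁ hinf₁ hfin₂ hinf₂
  · rw [sup_comm] at h
    obtain ⟨B₂, B₁, h1, h2, h3, h4⟩ :=
      h.exists_split_of_level_le hd.symm hα hfin₂ hinf₂ hfin₁ hinf₁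
    exact ⟨B₁, B₂, h1.symm, sup_comm B₁ B₂ ▸ h2, h4, h3⟩

theorem SameInvariants.nonempty_idealIso {A B : CompactOpens W} (h : SameInvariants A B) :
    Nonempty (IdealIso A B) :=
  nonempty_idealIso_of_backAndForth SameInvariants (fun _ _ => SameInvariants.symm)
    (fun _ => SameInvariants.eq_bot) (fun _ _ _ hd h => h.exists_split hd) h

end Uniqueness

/-! ### Isomorphisms of ideals preserve kernel and rank -/

section Invariance

variable {W : Type u} [TopologicalSpace W] {A B : CompactOpens W}

/-- The points `x ∈ A` and `y ∈ B` correspond to each other under an isomorphism `(A) → (B)`. -/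
def PointsMatch (f : Set.Iic A ≃o Set.Iic B) (x y : W) : Prop :=
  x ∈ A ∧ y ∈ B ∧ ∀ C : Set.Iic A, x ∈ (C : CompactOpens W) ↔ y ∈ (f C : CompactOpens W)

variable {f : Set.Iic A ≃o Set.Iic B} {x x' y y' : W}

theorem PointsMatch.symm (h : PointsMatch f x y) : PointsMatch f.symm y x :=
  ⟨h.2.1, h.1, fun D => by rw [h.2.2, f.apply_symm_apply]⟩

variable [OmegaStoneSpace W]

theorem PointsMatch.eq_right (h : PointsMatch f x y) (h' : PointsMatch f x y') : y = y' := by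
  by_contra hne
  obtain ⟨D, h1, h2⟩ := exists_compactOpens_between isCompact_singleton
    (B.isOpen.inter (isClosed_singleton (x := y')).isOpen_compl)
    (Set.singleton_subset_iff.2 ⟨h.2.1, hne⟩)
  have hx := (h.symm.2.2 ⟨D, fun z hz => (h2 hz).1⟩).1 (h1 rfl)
  exact (h2 ((h'.symm.2.2 ⟨D, fun z hz => (h2 hz).1⟩).2 hx)).2 rfl

/-- The images of the compact open neighbourhoods of `x` in `A` are nonempty, compact and directed,
so they meet; relative complements show that a common point lies in no other image. -/
theorem exists_pointsMatch (f : Set.Iic A ≃o Set.Iic B) (hx : x ∈ A) : ∃ y, PointsMatch f x y := by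
  let ι := {C : Set.Iic A // x ∈ (C : CompactOpens W)}
  have : Nonempty ι := ⟨⟨⊤, hx⟩⟩
  have hdir : Directed (· ⊇ ·) fun C : ι => ((f C.1 : CompactOpens W) : Set W) := by
    intro C D
    refine ⟨⟨C.1 ⊓ D.1, CompactOpens.mem_inf.2 ⟨C.2, D.2⟩⟩, ?_, ?_⟩
    · exact fun z hz => f.monotone (inf_le_left : C.1 ⊓ D.1 ≤ C.1) hz
    · exact fun z hz => f.monotone (inf_le_right : C.1 ⊓ D.1 ≤ D.1) hz
  have hne : ∀ C : ι, ((f C.1 : CompactOpens W) : Set W).Nonempty := by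
    intro C
    by_contra hC
    have h1 : f C.1 = f ⊥ := by
      refine Subtype.ext ?_
      rw [f.Iic_coe_bot]
      exact SetLike.coe_injective (Set.not_nonempty_iff_eq_empty.1 hC)
    have h2 := C.2
    rw [f.injective h1] at h2
    exact CompactOpens.notMem_bot h2
  obtain ⟨y, hy⟩ := IsCompact.nonempty_iInter_of_directed_nonempty_isCompact_isClosed _ hdir hne
    (fun C => (f C.1 : CompactOpens W).isCompact)
    (fun C => (f C.1 : CompactOpens W).isCompact.isClosed)
  rw [Set.mem_iInter] at hy
  refine ⟨y, hx, (f ⊤).2 (hy ⟨⊤, hx⟩), fun C => ⟨fun h => hy ⟨C, h⟩, fun h => ?_⟩⟩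
  by_contra hxC
  have h1 := hy ⟨⟨A \ C, Set.mem_Iic.2 sdiff_le⟩, CompactOpens.mem_sdiff.2 ⟨hx, hxC⟩⟩
  exact CompactOpens.disjoint_iff_forall.1
    ((f.Iic_disjoint_iff ⟨A \ C, Set.mem_Iic.2 sdiff_le⟩ C).2 disjoint_sdiff_self_left) y h1 h

theorem PointsMatch.exists_mem_nhd (h : PointsMatch f x y) {U : Set W} (hU : IsOpen U)
    (hy : y ∈ U) : ∃ C : CompactOpens W, x ∈ C ∧ ∀ z ∈ C, ∃ z' ∈ U, PointsMatch f z z' := by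
  obtain ⟨D, h1, h2⟩ := exists_compactOpens_between isCompact_singleton (B.isOpen.inter hU)
    (Set.singleton_subset_iff.2 ⟨h.2.1, hy⟩)
  have hD : D ≤ B := fun z hz => (h2 hz).1
  refine ⟨f.symm ⟨D, hD⟩, (h.symm.2.2 ⟨D, hD⟩).1 (h1 rfl), fun z hz => ?_⟩
  obtain ⟨z', hz'⟩ := exists_pointsMatch f ((f.symm ⟨D, hD⟩).2 hz)
  exact ⟨z', (h2 ((hz'.symm.2.2 ⟨D, hD⟩).2 hz)).2, hz'⟩

theorem PointsMatch.mem_cbSeq (h : PointsMatch f x y) {ξ : Ordinal.{u}} (hx : x ∈ cbSeq W ξ) :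
    y ∈ cbSeq W ξ := by
  induction ξ using Ordinal.limitRecOn generalizing x y with
  | zero => simp [cbSeq_zero]
  | add_one a ih =>
    refine mem_cbSeq_add_one.2 fun U hU hy => ?_
    obtain ⟨C, hxC, hC⟩ := h.exists_mem_nhd hU hy
    obtain ⟨z, hzC, hz, hne⟩ := mem_cbSeq_add_one.1 hx C C.isOpen hxC
    obtain ⟨z', hz'U, hz'⟩ := hC z hzC
    refine ⟨z', hz'U, ih hz' hz, ?_⟩
    rintro rfl
    exact hne (hz'.symm.eq_right h.symm)
  | limit a ha ih =>
    exact (mem_cbSeq_limit ha).2 fun η hη => ih η hη h ((mem_cbSeq_limit ha).1 hx η hη)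

theorem PointsMatch.mem_kernel (h : PointsMatch f x y) (hx : x ∈ kernel W) : y ∈ kernel W :=
  Set.mem_iInter.2 fun ξ => h.mem_cbSeq (kernel_subset_cbSeq ξ hx)

theorem PointsMatch.rankFn_le {x y : kernel W} (h : PointsMatch f x y) :
    rankFn x ≤ rankFn y := by
  refine Subtype.coe_le_coe.1 (le_of_forall_lt fun ξ hξ => ?_)
  rw [lt_rankFn_iff] at hξ ⊢
  refine mem_closure_iff.2 fun U hU hy => ?_
  obtain ⟨C, hxC, hC⟩ := h.exists_mem_nhd hU hy
  obtain ⟨z, hzC, hz, hzK⟩ := mem_closure_iff.1 hξ C C.isOpen hxC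
  obtain ⟨z', hz'U, hz'⟩ := hC z hzC
  exact ⟨z', hz'U, hz'.mem_cbSeq hz, fun hK => hzK (hz'.symm.mem_kernel hK)⟩

theorem exists_pointsMatch_kernel (f : Set.Iic A ≃o Set.Iic B) {x : kernel W}
    (hx : x ∈ kernelPart A) : ∃ y : kernel W, PointsMatch f x y := by
  obtain ⟨y, hy⟩ := exists_pointsMatch (W := W) f (x := (x : W)) hx
  exact ⟨⟨y, hy.mem_kernel x.2⟩, hy⟩

theorem exists_kernelPart_match (f : Set.Iic A ≃o Set.Iic B) {G : CompactOpens (kernel W)}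
    (hG : G ≤ kernelPart A) : ∃ H ≤ kernelPart B,
      ∀ x y : kernel W, PointsMatch f x y → (x ∈ G ↔ y ∈ H) := by
  obtain ⟨C, hC, rfl⟩ := exists_kernelPart_eq hG
  exact ⟨_, kernelPart_mono (f ⟨C, hC⟩).2, fun x y h => h.2.2 ⟨C, hC⟩⟩

/-- A trace is moved by lifting it to `A`, applying the isomorphism and restricting again; matching
of points shows that the lift does not matter. -/
theorem IdealIso.sigmaIso_kernelPart (e : IdealIso A B) :
    SigmaIso (sigmaMeasure W) (kernelPart A) (kernelPart B) := by
  let f := e.toOrderIso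
  choose F hF hFm using fun G : Set.Iic (kernelPart A) => exists_kernelPart_match f G.2
  choose F' hF' hFm' using fun H : Set.Iic (kernelPart B) => exists_kernelPart_match f.symm H.2
  refine ⟨IdealIso.ofOrderIso
    { toFun := fun G => ⟨F G, hF G⟩
      invFun := fun H => ⟨F' H, hF' H⟩
      left_inv := fun G => Subtype.ext (SetLike.ext fun x => ?_)
      right_inv := fun H => Subtype.ext (SetLike.ext fun y => ?_)
      map_rel_iff' := fun {G G'} => ⟨fun h x hx => ?_, fun h y hy => ?_⟩ }, fun G => ?_⟩
  · have key : x ∈ kernelPart A → (x ∈ F' ⟨F G, hF G⟩ ↔ x ∈ (G : CompactOpens (kernel W))) := by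
      intro hx
      obtain ⟨y, hy⟩ := exists_pointsMatch_kernel f hx
      exact (hFm' ⟨F G, hF G⟩ y x hy.symm).symm.trans (hFm G x y hy).symm
    exact ⟨fun h => (key (hF' _ h)).1 h, fun h => (key (G.2 h)).2 h⟩
  · have key : y ∈ kernelPart B → (y ∈ F ⟨F' H, hF' H⟩ ↔ y ∈ (H : CompactOpens (kernel W))) := by
      intro hy
      obtain ⟨x, hx⟩ := exists_pointsMatch_kernel f.symm hy
      exact (hFm ⟨F' H, hF' H⟩ x y hx.symm).symm.trans (hFm' H y x hx).symm
    exact ⟨fun h => (key (hF _ h)).1 h, fun h => (key (H.2 h)).2 h⟩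
  · obtain ⟨y, hy⟩ := exists_pointsMatch_kernel f (G.2 hx)
    exact (hFm G' x y hy).2 (h ((hFm G x y hy).1 hx))
  · obtain ⟨x, hx⟩ := exists_pointsMatch_kernel f.symm (hF G hy)
    exact (hFm G' x y hx.symm).1 (h ((hFm G x y hx.symm).2 hy))
  · change sigmaFun (F G) = sigmaFun (G : CompactOpens (kernel W))
    refine eq_of_forall_ge_iff fun w => ?_
    rw [sigmaFun_le_iff, sigmaFun_le_iff]
    constructor
    · intro h x hx
      obtain ⟨y, hy⟩ := exists_pointsMatch_kernel f (G.2 hx)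
      exact (ScriptW.ofOrdinal_le_ofOrdinal.2 hy.rankFn_le).trans (h y ((hFm G x y hy).1 hx))
    · intro h y hy
      obtain ⟨x, hx⟩ := exists_pointsMatch_kernel f.symm (hF G hy)
      exact (ScriptW.ofOrdinal_le_ofOrdinal.2 hx.rankFn_le).trans
        (h x ((hFm G x y hx.symm).2 hy))

end Invariance

/-! ### Closure properties of finite disjoint unions -/

section FiniteDisjointUnion

variable {R : Type u} [GeneralizedBooleanAlgebra R] {p : R → Prop} {A B : R}

theorem IsFiniteDisjointUnionOf.of_prop (h : p A) : IsFiniteDisjointUnionOf p A :=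
  ⟨1, fun _ => A, fun i j hij => (hij (Subsingleton.elim i j)).elim, fun _ => h, by simp⟩

theorem IsFiniteDisjointUnionOf.bot : IsFiniteDisjointUnionOf p (⊥ : R) :=
  ⟨0, Fin.elim0, fun i => i.elim0, fun i => i.elim0, by simp⟩

theorem IsFiniteDisjointUnionOf.sup (hA : IsFiniteDisjointUnionOf p A)
    (hB : IsFiniteDisjointUnionOf p B) (hd : Disjoint A B) :
    IsFiniteDisjointUnionOf p (A ⊔ B) := by
  obtain ⟨n, F, hF, hFp, rfl⟩ := hA
  obtain ⟨m, G, hG, hGp, rfl⟩ := hB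
  have hFG : ∀ i j, Disjoint (F i) (G j) := fun i j =>
    hd.mono (Finset.le_sup (Finset.mem_univ i)) (Finset.le_sup (Finset.mem_univ j))
  refine ⟨n + m, Fin.append F G, fun i j => ?_, fun i => ?_, ?_⟩
  · induction i using Fin.addCases with
    | left i =>
      induction j using Fin.addCases with
      | left j => simpa using fun hij => hF hij
      | right j => simpa using fun _ => hFG i j
    | right i =>
      induction j using Fin.addCases with
      | left j => simpa using fun _ => (hFG j i).symm
      | right j => simpa using fun hij => hG hij
  · induction i using Fin.addCases with
    | left i => simpa using hFp i
    | right i => simpa using hGp i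
  · apply le_antisymm
    · refine Finset.sup_le fun i _ => ?_
      induction i using Fin.addCases with
      | left i => simpa using le_sup_of_le_left (Finset.le_sup (f := F) (Finset.mem_univ i))
      | right i => simpa using le_sup_of_le_right (Finset.le_sup (f := G) (Finset.mem_univ i))
    · refine sup_le (Finset.sup_le fun i _ => ?_) (Finset.sup_le fun i _ => ?_)
      · have := Finset.le_sup (f := Fin.append F G) (Finset.mem_univ (Fin.castAdd m i))
        rwa [Fin.append_left] at this
      · have := Finset.le_sup (f := Fin.append F G) (Finset.mem_univ (Fin.natAdd n i))
        rwa [Fin.append_right] at this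

end FiniteDisjointUnion

/-! ### Transfer of primitivity between the space and its kernel -/

section Primitive

variable {W : Type u} [TopologicalSpace W] [OmegaStoneSpace W]

theorem IsPI.isSigmaPI_kernelPart {A : CompactOpens W} (h : IsPI A) :
    IsSigmaPI (sigmaMeasure W) (kernelPart A) := by
  intro G hG
  obtain ⟨C, hC, rfl⟩ := exists_kernelPart_eq hG
  rw [← kernelPart_sdiff]
  exact (h C hC).imp (fun ⟨e⟩ => e.sigmaIso_kernelPart) fun ⟨e⟩ => e.sigmaIso_kernelPart

theorem isSigmaPrimitive_of_isPrimitiveSpace (h : IsPrimitiveSpace W) :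
    IsSigmaPrimitive (sigmaMeasure W) := by
  intro G
  obtain ⟨A, hGA, -⟩ := exists_compactOpens_between (G.isCompact.image continuous_subtype_val)
    isOpen_univ (Set.subset_univ _)
  obtain ⟨C, -, rfl⟩ := exists_kernelPart_eq (A := A) (G := G) fun x hx => hGA ⟨x, hx, rfl⟩
  obtain ⟨n, F, hd, hF, rfl⟩ := h C
  refine ⟨n, fun i => kernelPart (F i), fun i j hij => disjoint_kernelPart (hd hij),
    fun i => (hF i).isSigmaPI_kernelPart, ?_⟩
  exact (Finset.apply_sup_eq_sup_comp kernelPart kernelPart_sup kernelPart_bot).symm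

/-- Whichever half of a splitting contains `x` has the invariants of `A`: empty trace, infinite
counts before `α`, one point at `α`, none afterwards. -/
theorem isPI_of_scatteredPart_eq_singleton {A : CompactOpens W} (hA : kernelPart A = ⊥)
    {α : Ordinal.{u}} {x : W} (hx : scatteredPart A α = {x}) : IsPI A := by
  have hmem : x ∈ scatteredPart A α := hx ▸ rfl
  have key : ∀ C ≤ A, x ∈ C → Nonempty (IdealIso C A) := by
    intro C hC hxC
    have hkC : kernelPart C = ⊥ := le_bot_iff.1 (hA ▸ kernelPart_mono hC)
    have hCα : scatteredPart C α = {x} := Set.Subset.antisymm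
      (hx ▸ scatteredPart_mono hC α)
      (Set.singleton_subset_iff.2 ⟨⟨hxC, hmem.1.2⟩, hmem.2⟩)
    refine SameInvariants.nonempty_idealIso ⟨?_, encard_scatteredPart_eq_of_level (α := α)
      (by rw [hkC, hA]) (hCα ▸ Set.finite_singleton x)
      (fun ξ hξ => infinite_scatteredPart_of_lt hξ (hCα ▸ Set.singleton_nonempty x))
      (by rw [hCα, hx])⟩
    rw [hkC, hA]
    exact SigmaIso.refl _ _
  intro B hB
  by_cases hxB : x ∈ B
  · exact Or.inl (key B hB hxB)
  · exact Or.inr (key _ sdiff_le (CompactOpens.mem_sdiff.2 ⟨hmem.1.1, hxB⟩))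

theorem isFiniteDisjointUnionOf_isPI_of_scattered (α : Ordinal.{u}) (A : CompactOpens W)
    (hA : kernelPart A = ⊥) (hα : scatteredPart A α = ∅) :
    IsFiniteDisjointUnionOf IsPI A := by
  induction α using WellFoundedLT.induction generalizing A with
  | ind α ih =>
  have hk : ∀ x ∈ A, x ∉ kernel W := fun x hx hK =>
    CompactOpens.notMem_bot (hA ▸ (show (⟨x, hK⟩ : kernel W) ∈ kernelPart A from hx))
  -- Asking for all `E` below `D` makes the property hereditary, so that overlapping neighbourhoods
  -- can be made disjoint in the compactness argument.
  have key : ∃ D : CompactOpens W, (A : Set W) ⊆ D ∧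
      ∀ E ≤ D, E ≤ A → IsFiniteDisjointUnionOf IsPI E := by
    refine A.isCompact'.induction_on (p := fun s => ∃ D : CompactOpens W, s ⊆ D ∧
      ∀ E ≤ D, E ≤ A → IsFiniteDisjointUnionOf IsPI E) ?_ ?_ ?_ ?_
    · refine ⟨⊥, Set.empty_subset _, fun E hE _ => ?_⟩
      rw [le_bot_iff.1 hE]
      exact .bot
    · rintro s t hst ⟨D, hD, h⟩
      exact ⟨D, hst.trans hD, h⟩
    · rintro s t ⟨D₁, hD₁, h₁⟩ ⟨D₂, hD₂, h₂⟩
      refine ⟨D₁ ⊔ D₂, Set.union_subset_union hD₁ hD₂, fun E hE hEA => ?_⟩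
      rw [← sup_inf_sdiff E D₁]
      exact (h₁ _ inf_le_right (inf_le_left.trans hEA)).sup
        (h₂ _ (sdiff_le_iff.2 hE) (sdiff_le.trans hEA)) (disjoint_iff.2 (inf_inf_sdiff E D₁))
    · intro x hx
      obtain ⟨β, hβ, hβ'⟩ := exists_cbRank (hk x hx)
      have hβα : β < α := by
        by_contra! hle
        exact Set.notMem_empty x (hα ▸ ⟨⟨hx, cbSeq_antitone hle hβ⟩, hk x hx⟩)
      -- In `N` the point `x` is alone at stage `β`: a subset containing `x` is PI, and any other is
      -- empty at stage `β < α`.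
      obtain ⟨N, hxN, hN⟩ := exists_compactOpens_between (isCompact_singleton (x := x))
        (isClosed_cbSeq_diff (Set.disjoint_singleton_left.2 hβ')).isOpen_compl
        (Set.singleton_subset_iff.2 fun h => h.2 rfl)
      refine ⟨N, mem_nhdsWithin_of_mem_nhds (N.isOpen.mem_nhds (hxN rfl)), N, subset_rfl,
        fun E hE hEA => ?_⟩
      have hkE : kernelPart E = ⊥ := le_bot_iff.1 (hA ▸ kernelPart_mono hEA)
      have hEx : scatteredPart E β ⊆ {x} := fun z hz => by
        by_contra hzx
        exact hN (hE hz.1.1) ⟨hz.1.2, hzx⟩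
      by_cases hxE : x ∈ E
      · refine .of_prop (isPI_of_scatteredPart_eq_singleton hkE (α := β)
          (Set.Subset.antisymm hEx (Set.singleton_subset_iff.2 ⟨⟨hxE, hβ⟩, hk x hx⟩)))
      · refine ih β hβα E hkE (Set.eq_empty_of_forall_notMem fun z hz => hxE ?_)
        obtain rfl := hEx hz
        exact hz.1.1
  obtain ⟨D, hD, h⟩ := key
  exact h A hD le_rfl

theorem exists_isPI_kernelPart_eq {A : CompactOpens W} {G : CompactOpens (kernel W)}
    (hG : G ≤ kernelPart A) (hPI : IsSigmaPI (sigmaMeasure W) G) :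
    ∃ C ≤ A, kernelPart C = G ∧ IsPI C := by
  -- The stage `α` will be the least upper bound of the ranks on `G`: large enough to make `C` empty
  -- there, small enough to force infinite counts below it.
  have hne : {α : Ordinal.{u} | ∀ x ∈ G, (rankFn x : Ordinal.{u}) ≤ α}.Nonempty :=
    ⟨ω₁, fun x _ => (rankFn x).2.le⟩
  have hα := csInf_mem hne
  have hlt : ∀ ξ < sInf {α : Ordinal.{u} | ∀ x ∈ G, (rankFn x : Ordinal.{u}) ≤ α},
      ∃ x ∈ G, ξ < (rankFn x : Ordinal.{u}) := fun ξ hξ => by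
    by_contra! h
    exact notMem_of_lt_csInf' hξ h
  generalize sInf {α : Ordinal.{u} | ∀ x ∈ G, (rankFn x : Ordinal.{u}) ≤ α} = α at hα hlt
  obtain ⟨C, hC, rfl, hCα⟩ := exists_le_kernelPart_eq_disjoint hG hα
  refine ⟨C, hC, rfl, ?_⟩
  have key : ∀ B ≤ C, SigmaIso (sigmaMeasure W) (kernelPart B) (kernelPart C) →
      Nonempty (IdealIso B C) := by
    intro B hB hσ
    have hBα : scatteredPart B α = ∅ := Set.subset_eq_empty (scatteredPart_mono hB α) hCα
    refine SameInvariants.nonempty_idealIso (SameInvariants.symm ⟨hσ.symm,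
      encard_scatteredPart_eq_of_level hσ.symm.measure_eq (hCα ▸ Set.finite_empty) (fun ξ hξ => ?_)
        (by rw [hCα, hBα])⟩)
    obtain ⟨x, hx, hxξ⟩ := hlt ξ hξ
    exact infinite_scatteredPart_of_lt_rankFn hx hxξ
  exact fun B hB => (hPI _ (kernelPart_mono hB)).imp (key B hB) (key _ sdiff_le)

/-- Each `F i` is lifted inside what remains of `A`, which keeps the lifts disjoint; the final
remainder has empty trace and is scattered. -/
theorem isFiniteDisjointUnionOf_isPI {n : ℕ} (F : Fin n → CompactOpens (kernel W))
    (hd : Pairwise fun i j => Disjoint (F i) (F j))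
    (hF : ∀ i, IsSigmaPI (sigmaMeasure W) (F i)) (A : CompactOpens W)
    (hA : Finset.univ.sup F = kernelPart A) : IsFiniteDisjointUnionOf IsPI A := by
  induction n generalizing A with
  | zero =>
    obtain ⟨ξ, hξ⟩ := exists_scatteredPart_eq_empty A
    exact isFiniteDisjointUnionOf_isPI_of_scattered ξ A (by simpa using hA.symm) hξ
  | succ n ih =>
    obtain ⟨C, hC, hCF, hPI⟩ := exists_isPI_kernelPart_eq
      (hA ▸ Finset.le_sup (Finset.mem_univ 0) : F 0 ≤ kernelPart A) (hF 0)
    have hsup : F 0 ⊔ Finset.univ.sup (fun i : Fin n => F i.succ) = kernelPart A := by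
      rw [← hA, Fin.univ_succ, Finset.sup_cons, Finset.sup_map]
      rfl
    have hrest := ih (fun i => F i.succ) (fun i j hij => hd fun h => hij (Fin.succ_injective _ h))
      (fun i => hF i.succ) (A \ C) (by
        rw [kernelPart_sdiff, hCF, ← hsup, sup_sdiff_left_self, eq_comm, sdiff_eq_left]
        refine Disjoint.symm (Finset.disjoint_sup_right.2 fun i _ => ?_)
        exact hd (Fin.succ_ne_zero i).symm)
    rw [← sup_sdiff_cancel_right hC]
    exact (IsFiniteDisjointUnionOf.of_prop hPI).sup hrest disjoint_sdiff_self_right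

end Primitive

theorem mainTheorem6 (W : Type u) [TopologicalSpace W] [OmegaStoneSpace W] :
    IsPrimitiveSpace W ↔ IsSigmaPrimitive (sigmaMeasure W) := by
  refine ⟨isSigmaPrimitive_of_isPrimitiveSpace, fun h A => ?_⟩
  obtain ⟨n, F, hd, hF, hA⟩ := h (kernelPart A)
  exact isFiniteDisjointUnionOf_isPI F hd hF A hA
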